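/- Let $(M,g)$ be an $n$-dimensional smooth semi-Riemannian manifold with Levi-Civita connection $\nabla$ and curvature $R(X,Y)=[\nabla_X,\nabla_Y]-\nabla_{[X,Y]}$, and let $\gamma:\mathbb R\to M$ be a closed geodesic, extended $1$-periodically to $\mathbb R$. Suppose that $(T_t)_{t\in\mathbb R}$, $T_t:\mathbb R^n\to T_{\gamma(t)}M$, is a smooth $1$-periodic orthonormal frame along $\gamma$: $g(T_te_i,T_te_j)=\epsilon_i\delta_{ij}$ with $\epsilon_i\in\{-1,1\}$ and $T_{t+1}=T_t$. Let $\Gamma_t,\overline R_t\in\mathrm{End}(\mathbb R^n)$ be given by $$\Gamma_t v=T_t^{-1}\tfrac{\mathrm D}{\mathrm dt}(T_tv)\quad(v\in\mathbb R^n\text{ constant}),\qquad \overline R_t v=T_t^{-1}\big(R(\dot\gamma(t),T_tv)\dot\gamma(t)\big),$$ extended $\mathbb C$-linearly to $\mathbb C^n$, and let $G(v,w)=\sum_i\epsilon_i v_i\overline{w_i}$ on $\mathbb C^n$. For $z\in\mathbb S^1=\{z\in\mathbb C:|z|=1\}$ let $b_z$ be the Hermitian form $$b_z(V,W)=G\big(\bar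 z V'(1)-V'(0),W(0)\big)$$ on the finite-dimensional complex vector space of the $C^2$ solutions $V$, with values in $\mathbb C^n$, of the Jacobi equation $$V''+2\Gamma_t V'+(\Gamma_t'+\Gamma_t^2-\overline R_t)V=0$$ that satisfy $V(1)=zV(0)$. Let $\mathrm n_-(b_z)$ be the index of $b_z$, i.e. the largest dimension of a subspace on which $b_z$ is negative definite, and for $N\in\mathbb N$ put $$\mathcal B_N=\sum_{k=0}^{N-1}\mathrm n_-\big(b_{e^{2\pi ik/N}}\big).$$ Then the limit $K_\gamma=\lim_{N\to\infty}\frac1N\mathcal B_N$ exists and is a nonnegative real number. It is zero if and only if the sequence $(\mathcal B_N)_N$ is bounded, which occurs if and only if $\mathrm n_-(b_z)=0$ for almost every $z\in\mathbb S^1$. If $(\mathcal B_N)_N$ is not bounded, then there is a constant $\alpha\in\mathbb R$ such that for all $N,P\in\mathbb N$ $$K_\gamma P-\alpha\le\mathcal B_{N+P}-\mathcal B_N\le K_\gamma P+\alpha.$$ -/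

import Mathlib

open scoped Manifold ContDiff Matrix Topology

noncomputable section

namespace SemiRiem

/-! ### Semi-Riemannian metrics, Christoffel symbols and curvature in charts -/

/-- A smooth semi-Riemannian metric on the `n`-dimensional manifold `M`: a smooth field of
symmetric nondegenerate bilinear forms on the tangent spaces, of arbitrary signature. -/
structure SemiRiemannianMetric (n : ℕ) (M : Type*) [TopologicalSpace M]
    [ChartedSpace (EuclideanSpace ℝ (Fin n)) M] [IsManifold (𝓡 n) ∞ M] where
  /-- the bilinear form on the tangent space at `x` -/
  inner : ∀ x : M, TangentSpace (𝓡 n) x →L[ℝ] TangentSpace (𝓡 n) x →L[ℝ] ℝ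
  symm : ∀ (x : M) (v w : TangentSpace (𝓡 n) x), inner x v w = inner x w v
  nondegenerate : ∀ (x : M) (v : TangentSpace (𝓡 n) x), (∀ w, inner x v w = 0) → v = 0
  contMDiff : ContMDiff (𝓡 n)
    ((𝓡 n).prod 𝓘(ℝ, EuclideanSpace ℝ (Fin n) →L[ℝ] EuclideanSpace ℝ (Fin n) →L[ℝ] ℝ)) ∞
    (fun x ↦ Bundle.TotalSpace.mk'
      (EuclideanSpace ℝ (Fin n) →L[ℝ] EuclideanSpace ℝ (Fin n) →L[ℝ] ℝ) x (inner x))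

/-- The partial derivative `∂ᵢ f (y)` of a function on `ℝⁿ`. -/
def pderiv {n : ℕ} (i : Fin n) (f : EuclideanSpace ℝ (Fin n) → ℝ)
    (y : EuclideanSpace ℝ (Fin n)) : ℝ :=
  fderiv ℝ f y (EuclideanSpace.single i 1)

section Charts

variable {n : ℕ} {M : Type*} [TopologicalSpace M] [ChartedSpace (EuclideanSpace ℝ (Fin n)) M]

/-- The coordinate vector `∂ᵢ` of the chart around `x₀`, at the point with coordinates `y`. -/
def coordVec (x₀ : M) (y : EuclideanSpace ℝ (Fin n)) (i : Fin n) :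
    TangentSpace (𝓡 n) ((extChartAt (𝓡 n) x₀).symm y) :=
  mfderiv 𝓘(ℝ, EuclideanSpace ℝ (Fin n)) (𝓡 n) (extChartAt (𝓡 n) x₀).symm y
    (EuclideanSpace.single i 1 : EuclideanSpace ℝ (Fin n))

/-- The components `(v¹, …, vⁿ)` of a tangent vector `v` at `p` in the chart around `x₀`. -/
def vecCoord (x₀ p : M) (v : TangentSpace (𝓡 n) p) : EuclideanSpace ℝ (Fin n) :=
  mfderiv (𝓡 n) 𝓘(ℝ, EuclideanSpace ℝ (Fin n)) (extChartAt (𝓡 n) x₀) p v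

/-- The velocity `γ̇(t)`. -/
def velocity (γ : ℝ → M) (t : ℝ) : TangentSpace (𝓡 n) (γ t) :=
  mfderiv 𝓘(ℝ, ℝ) (𝓡 n) γ t (1 : ℝ)

variable [IsManifold (𝓡 n) ∞ M]

/-- The matrix `(g_ij)` of the metric in the chart around `x₀`. -/
def metricMatrix (g : SemiRiemannianMetric n M) (x₀ : M) (y : EuclideanSpace ℝ (Fin n)) :
    Matrix (Fin n) (Fin n) ℝ :=
  Matrix.of fun i j ↦
    g.inner ((extChartAt (𝓡 n) x₀).symm y) (coordVec x₀ y i) (coordVec x₀ y j)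

/-- The Christoffel symbols of the Levi-Civita connection in the chart around `x₀`:
`Γᵏ_ij = ½ ∑_l gᵏˡ (∂ᵢ g_jl + ∂ⱼ g_il - ∂_l g_ij)`. -/
def christoffel (g : SemiRiemannianMetric n M) (x₀ : M) (k i j : Fin n)
    (y : EuclideanSpace ℝ (Fin n)) : ℝ :=
  (1 / 2 : ℝ) * ∑ l, (metricMatrix g x₀ y)⁻¹ k l *
    (pderiv i (fun y' ↦ metricMatrix g x₀ y' j l) y
      + pderiv j (fun y' ↦ metricMatrix g x₀ y' i l) y
      - pderiv l (fun y' ↦ metricMatrix g x₀ y' i j) y)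

/-- The components of the curvature tensor in the chart around `x₀`, with the convention
`R(X,Y) = [∇_X, ∇_Y] - ∇_[X,Y]`; that is, `R(∂ᵢ, ∂ⱼ) ∂ₖ = ∑_l (riemann g x₀ l k i j) ∂_l`. -/
def riemann (g : SemiRiemannianMetric n M) (x₀ : M) (l k i j : Fin n)
    (y : EuclideanSpace ℝ (Fin n)) : ℝ :=
  pderiv i (christoffel g x₀ l j k) y - pderiv j (christoffel g x₀ l i k) y
    + ∑ m, (christoffel g x₀ l i m y * christoffel g x₀ m j k y
      - christoffel g x₀ l j m y * christoffel g x₀ m i k y)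

/-- `W` is the covariant derivative `DV/dt` of the vector field `V` along the curve `γ`: in every
chart, `Wᵏ = (Vᵏ)' + ∑_ij Γᵏ_ij γ̇ⁱ Vʲ` (in particular the components of `V` are differentiable). -/
def IsCovDerivAlong (g : SemiRiemannianMetric n M) (γ : ℝ → M)
    (V W : ∀ t, TangentSpace (𝓡 n) (γ t)) : Prop :=
  ∀ (x₀ : M) (t : ℝ), γ t ∈ (chartAt (EuclideanSpace ℝ (Fin n)) x₀).source → ∀ k : Fin n,
    HasDerivAt (fun s ↦ vecCoord x₀ (γ s) (V s) k)
      (vecCoord x₀ (γ t) (W t) k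
        - ∑ i, ∑ j, christoffel g x₀ k i j (extChartAt (𝓡 n) x₀ (γ t))
            * vecCoord x₀ (γ t) (velocity γ t) i * vecCoord x₀ (γ t) (V t) j) t

/-- `W` is the vector field `R(γ̇, V) γ̇` along `γ`: in every chart,
`Wˡ = ∑_ijk Rˡ_kij γ̇ⁱ Vʲ γ̇ᵏ`. -/
def IsCurvatureAlong (g : SemiRiemannianMetric n M) (γ : ℝ → M)
    (V W : ∀ t, TangentSpace (𝓡 n) (γ t)) : Prop :=
  ∀ (x₀ : M) (t : ℝ), γ t ∈ (chartAt (EuclideanSpace ℝ (Fin n)) x₀).source → ∀ l : Fin n,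
    vecCoord x₀ (γ t) (W t) l =
      ∑ i, ∑ j, ∑ k, riemann g x₀ l k i j (extChartAt (𝓡 n) x₀ (γ t))
        * vecCoord x₀ (γ t) (velocity γ t) i * vecCoord x₀ (γ t) (V t) j
        * vecCoord x₀ (γ t) (velocity γ t) k

/-- A closed geodesic, extended `1`-periodically to `ℝ`: a smooth `1`-periodic curve with
`Dγ̇/dt = 0`. -/
structure IsClosedGeodesic (g : SemiRiemannianMetric n M) (γ : ℝ → M) : Prop where
  contMDiff : ContMDiff 𝓘(ℝ, ℝ) (𝓡 n) ∞ γ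
  periodic : Function.Periodic γ 1
  geodesic : IsCovDerivAlong g γ (velocity γ) (fun _ ↦ 0)

/-- A smooth periodic orthonormal frame along `γ`: `T j t` is the vector `T_t e_j` in the tangent
space at `γ t`, and `g(T_t e_i, T_t e_j) = ε_i δ_ij` with `ε_i ∈ {-1, 1}`. Periodicity is expressed
in the tangent bundle. -/
structure IsPeriodicOrthonormalFrame (g : SemiRiemannianMetric n M) (γ : ℝ → M) (ε : Fin n → ℝ)
    (T : Fin n → ∀ t, TangentSpace (𝓡 n) (γ t)) : Prop where
  sign : ∀ i, ε i = 1 ∨ ε i = -1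
  orthonormal : ∀ t i j, g.inner (γ t) (T i t) (T j t) = if i = j then ε i else 0
  contMDiff : ∀ j, ContMDiff 𝓘(ℝ, ℝ) (𝓡 n).tangent ∞
    (fun t ↦ (⟨γ t, T j t⟩ : TangentBundle (𝓡 n) M))
  periodic : ∀ j, Function.Periodic (fun t ↦ (⟨γ t, T j t⟩ : TangentBundle (𝓡 n) M)) 1

/-- `Γ` is the Christoffel symbol of the frame `T`, i.e. the matrix of
`Γ_t v = T_t⁻¹ (D/dt (T_t v))` for `v` constant: `D(T_t e_j)/dt = ∑ᵢ (Γ_t)_ij T_t e_i`. -/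
def IsFrameChristoffel (g : SemiRiemannianMetric n M) (γ : ℝ → M)
    (T : Fin n → ∀ t, TangentSpace (𝓡 n) (γ t)) (Γ : ℝ → Matrix (Fin n) (Fin n) ℝ) : Prop :=
  ∀ j, IsCovDerivAlong g γ (T j) (fun t ↦ ∑ i, Γ t i j • T i t)

/-- `Rbar` is the curvature endomorphism in the frame `T`, i.e. the matrix of
`T_t⁻¹ ∘ R(γ̇, ·)γ̇ ∘ T_t`: `R(γ̇, T_t e_j)γ̇ = ∑ᵢ (Rbar_t)_ij T_t e_i`. -/
def IsFrameCurvature (g : SemiRiemannianMetric n M) (γ : ℝ → M)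
    (T : Fin n → ∀ t, TangentSpace (𝓡 n) (γ t)) (Rbar : ℝ → Matrix (Fin n) (Fin n) ℝ) : Prop :=
  ∀ j, IsCurvatureAlong g γ (T j) (fun t ↦ ∑ i, Rbar t i j • T i t)

end Charts

/-! ### The Hermitian forms `b_z` and their indices -/

section Forms

variable {n : ℕ}

/-- Complexification of a real matrix. -/
def toC (A : Matrix (Fin n) (Fin n) ℝ) : Matrix (Fin n) (Fin n) ℂ :=
  A.map (fun x : ℝ ↦ (x : ℂ))

/-- The entrywise derivative `Γ'_r`. -/
def matDeriv (Γ : ℝ → Matrix (Fin n) (Fin n) ℝ) (r : ℝ) : Matrix (Fin n) (Fin n) ℝ :=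
  Matrix.of fun i j ↦ deriv (fun s ↦ Γ s i j) r

/-- The complex vector space of `C²` solutions `V : ℝ → ℂⁿ` of the Jacobi equation in the frame,
`V'' + 2 Γ V' + (Γ' + Γ² - Rbar) V = 0`. (The equation is linear with coefficients defined on `ℝ`,
so restriction to `[0,1]` identifies these with the solutions on `[0,1]`.) -/
def jacobiSolutions (Γ Rbar : ℝ → Matrix (Fin n) (Fin n) ℝ) : Submodule ℂ (ℝ → Fin n → ℂ) where
  carrier := {V | ContDiff ℝ 2 V ∧ ∀ r : ℝ,
    deriv (deriv V) r + (2 : ℂ) • (toC (Γ r) *ᵥ deriv V r)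
      + toC (matDeriv Γ r + Γ r * Γ r - Rbar r) *ᵥ V r = 0}
  zero_mem' := by
    refine ⟨contDiff_const, fun r ↦ ?_⟩
    have h : deriv (0 : ℝ → Fin n → ℂ) = 0 := by
      funext s
      simp
    simp [h]
  add_mem' := by
    rintro V W ⟨hV, eV⟩ ⟨hW, eW⟩
    refine ⟨hV.add hW, fun r ↦ ?_⟩
    have h1 : deriv (V + W) = deriv V + deriv W := by
      funext s
      exact deriv_add ((hV.differentiable (by norm_num)) s) ((hW.differentiable (by norm_num)) s)
    have dV : Differentiable ℝ (deriv V) :=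
      ((contDiff_succ_iff_deriv (n := 1)).1 hV).2.2.differentiable (by norm_num)
    have dW : Differentiable ℝ (deriv W) :=
      ((contDiff_succ_iff_deriv (n := 1)).1 hW).2.2.differentiable (by norm_num)
    have h2 : deriv (deriv V + deriv W) r = deriv (deriv V) r + deriv (deriv W) r :=
      deriv_add (dV r) (dW r)
    have := congrArg₂ (· + ·) (eV r) (eW r)
    simp only [add_zero] at this
    rw [h1, h2, ← this]
    simp only [Pi.add_apply, Matrix.mulVec_add, smul_add]
    abel
  smul_mem' := by
    rintro c V ⟨hV, eV⟩
    refine ⟨hV.const_smul c, fun r ↦ ?_⟩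
    have h1 : deriv (c • V) = c • deriv V := by
      funext s
      exact deriv_const_smul c ((hV.differentiable (by norm_num)) s)
    have dV : Differentiable ℝ (deriv V) :=
      ((contDiff_succ_iff_deriv (n := 1)).1 hV).2.2.differentiable (by norm_num)
    have h2 : deriv (c • deriv V) r = c • deriv (deriv V) r := deriv_const_smul c (dV r)
    have := congrArg (c • ·) (eV r)
    simp only [smul_zero] at this
    rw [h1, h2, ← this]
    simp only [Pi.smul_apply, Matrix.mulVec_smul, smul_add]
    rw [smul_comm c (2 : ℂ)]

/-- The space `J⁽²⁾(z)` of the solutions `V` of the Jacobi equation with `V(1) = z V(0)`. -/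
def twistedJacobi (Γ Rbar : ℝ → Matrix (Fin n) (Fin n) ℝ) (z : Circle) :
    Submodule ℂ (ℝ → Fin n → ℂ) where
  carrier := {V | V ∈ jacobiSolutions Γ Rbar ∧ V 1 = (z : ℂ) • V 0}
  zero_mem' := ⟨zero_mem _, by simp⟩
  add_mem' := by
    rintro V W ⟨hV, eV⟩ ⟨hW, eW⟩
    exact ⟨add_mem hV hW, by simp [eV, eW]⟩
  smul_mem' := by
    rintro c V ⟨hV, eV⟩
    exact ⟨Submodule.smul_mem _ c hV, by simp [eV, smul_smul, mul_comm]⟩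

/-- The sesquilinear extension to `ℂⁿ` of `G = diag(ε)`, conjugate-linear in the second slot. -/
def sesqG (ε : Fin n → ℝ) (v w : Fin n → ℂ) : ℂ :=
  ∑ i, (ε i : ℂ) * v i * starRingEnd ℂ (w i)

/-- The Hermitian form `b_z(V, W) = G(z̄ V'(1) - V'(0), W(0))` on `J⁽²⁾(z)`. -/
def bForm (ε : Fin n → ℝ) (Γ Rbar : ℝ → Matrix (Fin n) (Fin n) ℝ) (z : Circle)
    (V W : twistedJacobi Γ Rbar z) : ℂ :=
  sesqG ε (starRingEnd ℂ (z : ℂ) • deriv V.1 1 - deriv V.1 0) (W.1 0)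

/-- The index `n₋(b)` of a Hermitian form `b` on a complex vector space: the largest dimension of a
subspace on which `b` is negative definite (`b(v,v)` is real for Hermitian `b`). -/
def negIndex {X : Type*} [AddCommGroup X] [Module ℂ X] (b : X → X → ℂ) : ℕ :=
  sSup {d : ℕ | ∃ W : Submodule ℂ X, FiniteDimensional ℂ W ∧ Module.finrank ℂ W = d ∧
    ∀ v ∈ W, v ≠ 0 → (b v v).re < 0}

/-- The function `z ↦ n₋(b_z)` on the unit circle. -/
def nMinus (ε : Fin n → ℝ) (Γ Rbar : ℝ → Matrix (Fin n) (Fin n) ℝ) (z : Circle) : ℕ :=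
  negIndex (bForm ε Γ Rbar z)

/-- The sequence `B_N = ∑_{k=0}^{N-1} n₋(b_{exp(2πik/N)})`. -/
def BSeq (ε : Fin n → ℝ) (Γ Rbar : ℝ → Matrix (Fin n) (Fin n) ℝ) (N : ℕ) : ℕ :=
  ∑ k ∈ Finset.range N, nMinus ε Γ Rbar (Circle.exp (2 * Real.pi * k / N))

end Forms

end SemiRiem

end

/-! The form $b_z$ sees a solution only through its values and derivatives at $0$ and $1$, which
fill a finite-dimensional space. In coordinates there, $\mathrm n_-(b_z)$ is the negative index of a
Hermitian matrix $H(z)$ on $\ker L(z)$, with entries affine in $z$ and $\bar z$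
(`exists_matrices_nMinus`). Hence $H$ and $L$ are real analytic in $t$ for $z=e^{it}$.

The kernel may jump in dimension, so the pair is replaced by the bordered matrix
$\begin{pmatrix}H&L^*\\L&0\end{pmatrix}$, whose negative index is the wanted one plus
$\operatorname{rank}L$ (`negDim_fromBlocks`). The ranks of analytic families are constant off
finitely many points of $[0,2\pi]$. Where the rank of a continuous Hermitian family is locally
constant, so is its index (`eventually_negDim_eq`). Thus $t\mapsto\mathrm n_-(b_{e^{it}})$ is
bounded and piecewise constant with finitely many exceptional points.

For such a function the Riemann sum $\mathcal B_N$ differs from $N$ times the mean $K$ by at most a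
constant $D$ (`riemannSum_piecewise_const`). All the claims follow from $|\mathcal B_N-NK|\le D$. -/

namespace SemiRiem

/-! ### Negative dimension of a real-valued function on a complex vector space -/

/-- There is a `d`-dimensional subspace on which `q` is negative definite, parametrized by `ℂᵈ`. -/
def HasNeg {X : Type*} [AddCommGroup X] [Module ℂ X] (q : X → ℝ) (d : ℕ) : Prop :=
  ∃ φ : (Fin d → ℂ) →ₗ[ℂ] X, ∀ x, x ≠ 0 → q (φ x) < 0

/-- The largest dimension of a subspace on which `q` is negative definite. -/
noncomputable def negDim {X : Type*} [AddCommGroup X] [Module ℂ X] (q : X → ℝ) : ℕ :=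
  sSup {d | HasNeg q d}

section NegDim

variable {X Y : Type*} [AddCommGroup X] [Module ℂ X] [AddCommGroup Y] [Module ℂ Y]

theorem HasNeg.of_linearMap [FiniteDimensional ℂ Y] {q : X → ℝ} (φ : Y →ₗ[ℂ] X)
    (h : ∀ y, y ≠ 0 → q (φ y) < 0) : HasNeg q (Module.finrank ℂ Y) := by
  let e := (Module.finBasis ℂ Y).equivFun.symm
  exact ⟨φ ∘ₗ e.toLinearMap, fun x hx ↦ h _ (by simpa using hx)⟩

theorem HasNeg.comp {q : X → ℝ} {q' : Y → ℝ} {d : ℕ} (h : HasNeg q d) (φ : X →ₗ[ℂ] Y)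
    (hq : ∀ x, q x < 0 → q' (φ x) < 0) : HasNeg q' d := by
  obtain ⟨ψ, hψ⟩ := h
  exact ⟨φ ∘ₗ ψ, fun x hx ↦ hq _ (hψ x hx)⟩

/-- The two maps need not be inverse to each other, nor preserve the values: composing a
parametrization of a negative subspace with either one only requires that negative vectors stay
negative. -/
theorem negDim_congr {q : X → ℝ} {q' : Y → ℝ} (f : X →ₗ[ℂ] Y) (g : Y →ₗ[ℂ] X)
    (hf : ∀ x, q x < 0 → q' (f x) < 0) (hg : ∀ y, q' y < 0 → q (g y) < 0) :
    negDim q = negDim q' := by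
  unfold negDim
  congr 1
  exact Set.ext fun d ↦ ⟨fun (h : HasNeg q d) ↦ h.comp f hf, fun (h : HasNeg q' d) ↦ h.comp g hg⟩

/-- A nonzero kernel vector would give `q 0 < 0`. This is why `HasNeg` need not ask for injectivity.
-/
theorem HasNeg.injective {q : X → ℝ} (h0 : q 0 = 0) {d : ℕ} {φ : (Fin d → ℂ) →ₗ[ℂ] X}
    (h : ∀ x, x ≠ 0 → q (φ x) < 0) : Function.Injective φ := by
  rw [injective_iff_map_eq_zero]
  intro x hx
  by_contra hne
  have := h x hne
  rw [hx, h0] at this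
  exact lt_irrefl _ this

theorem HasNeg.le_finrank [FiniteDimensional ℂ X] {q : X → ℝ} (h0 : q 0 = 0) {d : ℕ}
    (h : HasNeg q d) : d ≤ Module.finrank ℂ X := by
  obtain ⟨φ, hφ⟩ := h
  simpa using LinearMap.finrank_le_finrank_of_injective (HasNeg.injective h0 hφ)

theorem HasNeg.le_negDim [FiniteDimensional ℂ X] {q : X → ℝ} (h0 : q 0 = 0) {d : ℕ}
    (h : HasNeg q d) : d ≤ negDim q :=
  le_csSup ⟨_, fun _ hd ↦ HasNeg.le_finrank h0 hd⟩ h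

theorem hasNeg_negDim [FiniteDimensional ℂ X] {q : X → ℝ} (h0 : q 0 = 0) :
    HasNeg q (negDim q) :=
  Nat.sSup_mem (s := {d | HasNeg q d}) ⟨0, 0, fun _ hx ↦ (hx (Subsingleton.elim _ _)).elim⟩
    ⟨_, fun _ hd ↦ HasNeg.le_finrank h0 hd⟩

theorem negDim_le_finrank [FiniteDimensional ℂ X] {q : X → ℝ} (h0 : q 0 = 0) :
    negDim q ≤ Module.finrank ℂ X :=
  (hasNeg_negDim h0).le_finrank h0

theorem negIndex_eq_negDim (b : X → X → ℂ) (h0 : b 0 0 = 0) :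
    negIndex b = negDim fun x ↦ (b x x).re := by
  unfold negIndex negDim
  congr 1
  ext d
  constructor
  · rintro ⟨W, hW, rfl, h⟩
    exact HasNeg.of_linearMap (q := fun x ↦ (b x x).re) W.subtype
      fun y hy ↦ h y y.2 (by simpa using hy)
  · rintro ⟨φ, hφ⟩
    refine ⟨LinearMap.range φ, inferInstance, ?_, ?_⟩
    · rw [LinearMap.finrank_range_of_inj (HasNeg.injective (q := fun x ↦ (b x x).re) (by simp [h0]) hφ)]
      simp
    · rintro _ ⟨x, rfl⟩ hx
      exact hφ x (by rintro rfl; simp at hx)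

end NegDim

/-- Negative definiteness of a continuous family of quadratic functions is an open condition. -/
theorem eventually_negDef {T X : Type*} [TopologicalSpace T] [NormedAddCommGroup X]
    [NormedSpace ℂ X] [FiniteDimensional ℂ X] {q : T → X → ℝ}
    (hc : Continuous fun p : T × X ↦ q p.1 p.2)
    (hq : ∀ t (c : ℂ) x, q t (c • x) = ‖c‖ ^ 2 * q t x) {t₀ : T}
    (h : ∀ x, x ≠ 0 → q t₀ x < 0) : ∀ᶠ t in 𝓝 t₀, ∀ x, x ≠ 0 → q t x < 0 := by
  have : ProperSpace X := FiniteDimensional.proper ℂ X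
  -- Compactness of the unit sphere makes the neighbourhood uniform in `x`; homogeneity then reaches
  -- all nonzero vectors.
  have key : ∀ᶠ t in 𝓝 t₀, ∀ x ∈ Metric.sphere (0 : X) 1, q t x < 0 := by
    refine (isCompact_sphere (0 : X) 1).eventually_forall_of_forall_eventually fun y hy ↦ ?_
    refine hc.continuousAt.eventually_lt continuousAt_const (h y ?_)
    rintro rfl
    simp at hy
  filter_upwards [key] with t ht x hx
  have hn : 0 < ‖x‖ := norm_pos_iff.2 hx
  have h1 := ht (((‖x‖ : ℂ)⁻¹) • x) (by simp [norm_smul, hn.ne'])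
  rw [hq] at h1
  exact neg_of_mul_neg_right h1 (by positivity)

/-! ### Quadratic forms of Hermitian matrices -/

section Matrix

variable {ι κ : Type*} [Fintype ι] [Fintype κ]

/-- The real part of `x* H x`. -/
noncomputable def quadForm (H : Matrix ι ι ℂ) (x : ι → ℂ) : ℝ := (star x ⬝ᵥ H *ᵥ x).re

@[simp] theorem quadForm_zero (H : Matrix ι ι ℂ) : quadForm H 0 = 0 := by simp [quadForm]

theorem quadForm_smul (H : Matrix ι ι ℂ) (c : ℂ) (x : ι → ℂ) :
    quadForm H (c • x) = ‖c‖ ^ 2 * quadForm H x := by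
  have : star c * c = ((‖c‖ ^ 2 : ℝ) : ℂ) := by
    rw [mul_comm]
    simpa [Complex.normSq_eq_norm_sq] using Complex.mul_conj c
  simp only [quadForm, star_smul, Matrix.mulVec_smul, smul_dotProduct, dotProduct_smul, smul_eq_mul]
  rw [← mul_assoc, mul_comm c, this, Complex.re_ofReal_mul]

theorem quadForm_neg (H : Matrix ι ι ℂ) (x : ι → ℂ) : quadForm (-H) x = -quadForm H x := by
  simp [quadForm, Matrix.neg_mulVec]

theorem continuous_quadForm {T : Type*} [TopologicalSpace T] {H : T → Matrix ι ι ℂ}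
    {f : T → ι → ℂ} (hH : Continuous H) (hf : Continuous f) :
    Continuous fun t ↦ quadForm (H t) (f t) := by
  unfold quadForm
  exact Complex.continuous_re.comp (hf.star.dotProduct (hH.matrix_mulVec hf))

/-- The same subspace serves for all nearby parameters, so the negative index is lower
semicontinuous. -/
theorem eventually_hasNeg {T : Type*} [TopologicalSpace T] {H : T → Matrix ι ι ℂ}
    (hH : Continuous H) {d : ℕ} {t₀ : T} (h : HasNeg (quadForm (H t₀)) d) :
    ∀ᶠ t in 𝓝 t₀, HasNeg (quadForm (H t)) d := by
  obtain ⟨φ, hφ⟩ := h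
  have hφc : Continuous φ := φ.continuous_of_finiteDimensional
  have := eventually_negDef (q := fun t x ↦ quadForm (H t) (φ x))
    (continuous_quadForm (hH.comp continuous_fst) (hφc.comp continuous_snd))
    (fun t c x ↦ by simp [quadForm_smul]) hφ
  filter_upwards [this] with t ht using ⟨φ, ht⟩

theorem re_star_dotProduct_self (v : ι → ℂ) : (star v ⬝ᵥ v).re = ∑ i, ‖v i‖ ^ 2 := by
  simp only [dotProduct, Complex.re_sum]
  refine Finset.sum_congr rfl fun i _ ↦ ?_
  rw [Pi.star_apply, mul_comm, Complex.star_def, Complex.mul_conj, Complex.normSq_eq_norm_sq,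
    Complex.ofReal_re]

theorem re_star_dotProduct_self_nonneg (v : ι → ℂ) : 0 ≤ (star v ⬝ᵥ v).re := by
  rw [re_star_dotProduct_self]
  positivity

theorem re_star_dotProduct_self_pos {v : ι → ℂ} (hv : v ≠ 0) : 0 < (star v ⬝ᵥ v).re := by
  rw [re_star_dotProduct_self]
  obtain ⟨i, hi⟩ := Function.ne_iff.1 hv
  have := norm_pos_iff.2 hi
  exact Finset.sum_pos' (fun _ _ ↦ by positivity) ⟨i, Finset.mem_univ _, by positivity⟩

theorem hermitian_dotProduct_comm {H : Matrix ι ι ℂ} (hH : H.IsHermitian) (x y : ι → ℂ) :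
    star (star x ⬝ᵥ H *ᵥ y) = star y ⬝ᵥ H *ᵥ x := by
  rw [Matrix.star_dotProduct, star_star, Matrix.star_mulVec, hH.eq, Matrix.dotProduct_mulVec]

/-- `H` is injective on the sum of a negative and a positive subspace: if `H u + H v = 0`, pairing
with `u` and with `v` shows that the form takes the same value at both, and the opposite signs force
both to vanish. -/
theorem add_le_rank_of_hasNeg {H : Matrix ι ι ℂ} (hH : H.IsHermitian) {p r : ℕ}
    (hp : HasNeg (quadForm H) p) (hr : HasNeg (quadForm (-H)) r) : p + r ≤ H.rank := by
  obtain ⟨φ, hφ⟩ := hp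
  obtain ⟨ψ, hψ⟩ := hr
  let f : ((Fin p → ℂ) × (Fin r → ℂ)) →ₗ[ℂ] LinearMap.range H.mulVecLin :=
    H.mulVecLin.rangeRestrict ∘ₗ (φ.coprod ψ)
  have hf : Function.Injective f := by
    rw [injective_iff_map_eq_zero]
    rintro ⟨x, y⟩ hxy
    have h0 : H *ᵥ φ x + H *ᵥ ψ y = 0 := by
      have := congrArg Subtype.val hxy
      simpa [f, Matrix.mulVec_add] using this
    have h1 : quadForm H (φ x) = -(star (φ x) ⬝ᵥ H *ᵥ ψ y).re := by
      rw [quadForm, eq_neg_of_add_eq_zero_left h0]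
      simp
    have h2 : quadForm H (ψ y) = -(star (ψ y) ⬝ᵥ H *ᵥ φ x).re := by
      rw [quadForm, eq_neg_of_add_eq_zero_right h0]
      simp
    have h3 : (star (ψ y) ⬝ᵥ H *ᵥ φ x).re = (star (φ x) ⬝ᵥ H *ᵥ ψ y).re := by
      rw [← hermitian_dotProduct_comm hH]
      simp
    have h4 : quadForm H (φ x) = quadForm H (ψ y) := by rw [h1, h2, h3]
    have hx : x = 0 := by
      by_contra hx
      have a := hφ x hx
      by_cases hy : y = 0
      · simp [h4, hy] at a
      · have b := hψ y hy
        rw [quadForm_neg] at b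
        linarith
    have hy : y = 0 := by
      by_contra hy
      have b := hψ y hy
      rw [quadForm_neg, ← h4, hx] at b
      simp at b
    simp [hx, hy]
  have := LinearMap.finrank_le_finrank_of_injective hf
  simpa [Matrix.rank] using this

/-- The negative index of the restriction of a Hermitian form to the kernel of a linear map,
through the bordered matrix. -/
theorem negDim_fromBlocks (H : Matrix ι ι ℂ) (L : Matrix κ ι ℂ) :
    negDim (quadForm (Matrix.fromBlocks H Lᴴ L 0)) =
      negDim (fun x : LinearMap.ker L.mulVecLin ↦ quadForm H x) + L.rank := by
  have hform : ∀ (x : ι → ℂ) (y : κ → ℂ), quadForm (Matrix.fromBlocks H Lᴴ L 0) (Sum.elim x y) =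
      quadForm H x + 2 * (star y ⬝ᵥ L *ᵥ x).re := by
    intro x y
    have h1 : (star (Sum.elim x y) : ι ⊕ κ → ℂ) = Sum.elim (star x) (star y) := by
      ext (i | i) <;> simp
    have h2 : (star x ⬝ᵥ Lᴴ *ᵥ y).re = (star y ⬝ᵥ L *ᵥ x).re := by
      rw [Matrix.dotProduct_mulVec, ← Matrix.star_mulVec, Matrix.star_dotProduct]
      simp
    rw [quadForm, h1, Matrix.fromBlocks_mulVec, sumElim_dotProduct_sumElim]
    simp only [Sum.elim_comp_inl, Sum.elim_comp_inr, Matrix.zero_mulVec, add_zero,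
      dotProduct_add, Complex.add_re, h2, quadForm]
    ring
  have hz : (fun x : LinearMap.ker L.mulVecLin ↦ quadForm H x) 0 = 0 := by simp
  apply le_antisymm
  -- In a negative subspace of the bordered form, the vectors with first component in `ker L` have
  -- codimension at most `L.rank`, and on them the cross term vanishes.
  · obtain ⟨φ, hφ⟩ := hasNeg_negDim (quadForm_zero (Matrix.fromBlocks H Lᴴ L 0))
    let fst : ((ι ⊕ κ) → ℂ) →ₗ[ℂ] (ι → ℂ) := LinearMap.funLeft ℂ ℂ Sum.inl
    let g := L.mulVecLin ∘ₗ fst ∘ₗ φ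
    have h1 : Module.finrank ℂ (LinearMap.ker g) ≤
        negDim (fun x : LinearMap.ker L.mulVecLin ↦ quadForm H x) := by
      refine HasNeg.le_negDim (q := fun x : LinearMap.ker L.mulVecLin ↦ quadForm H x) hz ?_
      refine HasNeg.of_linearMap ((fst ∘ₗ φ).restrict (p := LinearMap.ker g)
        (fun x hx ↦ by simpa [g] using hx)) fun y hy ↦ ?_
      have hy' := hφ y (by simpa using hy)
      have hk : L *ᵥ (fst (φ y)) = 0 := y.2
      have hs : φ y = Sum.elim (fst (φ y)) (fun k ↦ φ y (Sum.inr k)) := by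
        ext (i | i) <;> rfl
      rw [hs, hform, hk] at hy'
      simpa using hy'
    have h2 := LinearMap.finrank_range_add_finrank_ker g
    have h3 : Module.finrank ℂ (LinearMap.range g) ≤ L.rank :=
      Submodule.finrank_mono (LinearMap.range_comp_le_range _ _)
    simp only [Module.finrank_fintype_fun_eq_card, Fintype.card_fin] at h2
    omega
  · have hneg := hasNeg_negDim (q := fun x : LinearMap.ker L.mulVecLin ↦ quadForm H x) hz
    generalize negDim (fun x : LinearMap.ker L.mulVecLin ↦ quadForm H x) = p at hneg ⊢
    obtain ⟨φ, hφ⟩ := hneg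
    obtain ⟨U, hU⟩ := Submodule.exists_isCompl (LinearMap.ker L.mulVecLin)
    have hdim : Module.finrank ℂ U = L.rank := by
      have h1 := Submodule.finrank_add_eq_of_isCompl hU
      have h2 := LinearMap.finrank_range_add_finrank_ker L.mulVecLin
      rw [Matrix.rank]
      omega
    let α : ((Fin p → ℂ) × U) →ₗ[ℂ] (ι → ℂ) :=
      (LinearMap.ker L.mulVecLin).subtype ∘ₗ φ ∘ₗ LinearMap.fst ℂ _ _
    let β : ((Fin p → ℂ) × U) →ₗ[ℂ] (ι → ℂ) := U.subtype ∘ₗ LinearMap.snd ℂ _ _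
    have hα : ∀ w, L *ᵥ α w = 0 := fun w ↦ (φ w.1).2
    -- This is the bordered form at `(α + s β, -s⁻¹ L β)`, since `L α = 0`. At `s = 0` it is
    -- negative definite: `H` is negative on the image of `α`, and `L` is injective on the
    -- complement `U`. Openness then provides a small `s > 0`, where `s⁻¹` makes sense.
    let q : ℝ → ((Fin p → ℂ) × U) → ℝ := fun s w ↦
      quadForm H (α w + (s : ℂ) • β w) - 2 * (star (L *ᵥ β w) ⬝ᵥ (L *ᵥ β w)).re
    have hev : ∀ᶠ s in 𝓝 (0 : ℝ), ∀ w, w ≠ 0 → q s w < 0 := by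
      refine eventually_negDef ?_ ?_ ?_
      · have ha : Continuous α := α.continuous_of_finiteDimensional
        have hb : Continuous β := β.continuous_of_finiteDimensional
        refine (continuous_quadForm continuous_const ?_).sub
          (continuous_const.mul (Complex.continuous_re.comp ?_))
        · fun_prop
        · have : Continuous fun w : ℝ × ((Fin p → ℂ) × U) ↦ L *ᵥ β w.2 :=
            continuous_const.matrix_mulVec (hb.comp continuous_snd)
          exact this.star.dotProduct this
      · intro t c w
        have hn : ∀ v : κ → ℂ, (star (c • v) ⬝ᵥ (c • v)).re = ‖c‖ ^ 2 * (star v ⬝ᵥ v).re :=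
          fun v ↦ by
            rw [re_star_dotProduct_self, re_star_dotProduct_self, Finset.mul_sum]
            simp [mul_pow]
        simp only [q, map_smul, Matrix.mulVec_smul, hn, smul_comm (t : ℂ) c, ← smul_add,
          quadForm_smul]
        ring
      · rintro ⟨x, u⟩ hw
        simp only [q, Complex.ofReal_zero, zero_smul, add_zero]
        have hnn : 0 ≤ (star (L *ᵥ β (x, u)) ⬝ᵥ (L *ᵥ β (x, u))).re :=
          re_star_dotProduct_self_nonneg _
        by_cases hx : x = 0
        · have hu : u ≠ 0 := by
            rintro rfl
            exact hw (by simp [hx])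
          have hLu : L *ᵥ β (x, u) ≠ 0 := by
            intro h0
            have : (u : ι → ℂ) ∈ LinearMap.ker L.mulVecLin ⊓ U := ⟨h0, u.2⟩
            rw [hU.inf_eq_bot] at this
            exact hu (by simpa using this)
          have hpos : 0 < (star (L *ᵥ β (x, u)) ⬝ᵥ (L *ᵥ β (x, u))).re :=
            re_star_dotProduct_self_pos hLu
          have : α (x, u) = 0 := by simp [α, hx]
          rw [this, quadForm_zero]
          linarith
        · have : quadForm H (α (x, u)) < 0 := hφ x hx
          linarith
    obtain ⟨s, hs, hs0⟩ := ((hev.filter_mono nhdsWithin_le_nhds).and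
      (self_mem_nhdsWithin : ∀ᶠ s in 𝓝[>] (0 : ℝ), s ∈ Set.Ioi 0)).exists
    have hs0' : (s : ℂ) ≠ 0 := by exact_mod_cast (ne_of_gt hs0)
    have hN : HasNeg (quadForm (Matrix.fromBlocks H Lᴴ L 0))
        (Module.finrank ℂ ((Fin p → ℂ) × U)) := by
      refine HasNeg.of_linearMap ((LinearEquiv.sumArrowLequivProdArrow ι κ ℂ ℂ).symm.toLinearMap ∘ₗ
        ((α + (s : ℂ) • β).prod (-(s : ℂ)⁻¹ • (L.mulVecLin ∘ₗ β)))) fun w hw ↦ ?_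
      have : ((LinearEquiv.sumArrowLequivProdArrow ι κ ℂ ℂ).symm.toLinearMap ∘ₗ
        ((α + (s : ℂ) • β).prod (-(s : ℂ)⁻¹ • (L.mulVecLin ∘ₗ β)))) w =
          Sum.elim (α w + (s : ℂ) • β w) (-(s : ℂ)⁻¹ • (L *ᵥ β w)) := by
        ext (i | i) <;> rfl
      rw [this, hform]
      convert hs w hw using 1
      simp only [q, Matrix.mulVec_add, hα, zero_add, Matrix.mulVec_smul, star_smul, smul_dotProduct,
        dotProduct_smul, smul_eq_mul]
      rw [← mul_assoc]
      have : (s : ℂ) * star (-(s : ℂ)⁻¹) = -1 := by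
        rw [← Complex.ofReal_inv, ← Complex.ofReal_neg]
        simp only [Complex.star_def, Complex.conj_ofReal]
        push_cast
        field_simp
      rw [this]
      simp
      ring
    have := hN.le_negDim (quadForm_zero _)
    rw [Module.finrank_prod, hdim] at this
    simpa using this

/-! ### Inertia through eigenvalues and local constancy of the index -/

variable [DecidableEq ι]

theorem quadForm_eigenvectorUnitary {H : Matrix ι ι ℂ} (hH : H.IsHermitian) (y : ι → ℂ) :
    quadForm H ((hH.eigenvectorUnitary : Matrix ι ι ℂ) *ᵥ y) =
      ∑ i, hH.eigenvalues i * ‖y i‖ ^ 2 := by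
  set U : Matrix ι ι ℂ := (hH.eigenvectorUnitary : Matrix ι ι ℂ) with hU
  have h : star U * H * U = Matrix.diagonal (RCLike.ofReal ∘ hH.eigenvalues) := by
    have := hH.conjStarAlgAut_star_eigenvectorUnitary
    rw [Unitary.conjStarAlgAut_apply] at this
    simpa using this
  have h2 : star (U *ᵥ y) ⬝ᵥ H *ᵥ (U *ᵥ y) = star y ⬝ᵥ (star U * H * U) *ᵥ y := by
    rw [Matrix.star_mulVec, ← Matrix.dotProduct_mulVec, Matrix.mulVec_mulVec, Matrix.mulVec_mulVec,
      Matrix.star_eq_conjTranspose, Matrix.mul_assoc]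
  rw [quadForm, h2, h]
  simp only [dotProduct, Matrix.mulVec_diagonal, Complex.re_sum]
  refine Finset.sum_congr rfl fun i _ ↦ ?_
  have : star (y i) * y i = ((‖y i‖ ^ 2 : ℝ) : ℂ) := by
    rw [mul_comm]
    simpa [Complex.normSq_eq_norm_sq] using Complex.mul_conj (y i)
  rw [Pi.star_apply, mul_left_comm, this]
  exact Complex.re_ofReal_mul _ _

theorem hasNeg_card_eigenvalues_neg {H : Matrix ι ι ℂ} (hH : H.IsHermitian) :
    HasNeg (quadForm H) (Fintype.card {i // hH.eigenvalues i < 0}) := by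
  let E : ({i // hH.eigenvalues i < 0} → ℂ) →ₗ[ℂ] (ι → ℂ) :=
    Function.ExtendByZero.linearMap ℂ Subtype.val
  have h := HasNeg.of_linearMap (q := quadForm H)
    ((hH.eigenvectorUnitary : Matrix ι ι ℂ).mulVecLin ∘ₗ E) fun y hy ↦ ?_
  · simpa using h
  · rw [LinearMap.comp_apply, Matrix.mulVecLin_apply, quadForm_eigenvectorUnitary]
    have hE : ∀ i, E y i.1 = y i := fun i ↦ Subtype.val_injective.extend_apply y 0 i
    have hE' : ∀ i, ¬ hH.eigenvalues i < 0 → E y i = 0 := fun i hi ↦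
      Function.extend_apply' _ _ _ (by rintro ⟨a, rfl⟩; exact hi a.2)
    obtain ⟨i₀, hi₀⟩ := Function.ne_iff.1 hy
    refine Finset.sum_neg' (fun i _ ↦ ?_) ⟨i₀.1, Finset.mem_univ _, ?_⟩
    · by_cases hi : hH.eigenvalues i < 0
      · exact mul_nonpos_of_nonpos_of_nonneg hi.le (by positivity)
      · simp [hE' i hi]
    · rw [hE]
      exact mul_neg_of_neg_of_pos i₀.2 (by have := norm_pos_iff.2 hi₀; positivity)

theorem hasNeg_neg_card_eigenvalues_pos {H : Matrix ι ι ℂ} (hH : H.IsHermitian) :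
    HasNeg (quadForm (-H)) (Fintype.card {i // 0 < hH.eigenvalues i}) := by
  let E : ({i // 0 < hH.eigenvalues i} → ℂ) →ₗ[ℂ] (ι → ℂ) :=
    Function.ExtendByZero.linearMap ℂ Subtype.val
  have h := HasNeg.of_linearMap (q := quadForm (-H))
    ((hH.eigenvectorUnitary : Matrix ι ι ℂ).mulVecLin ∘ₗ E) fun y hy ↦ ?_
  · simpa using h
  · rw [LinearMap.comp_apply, Matrix.mulVecLin_apply, quadForm_neg, quadForm_eigenvectorUnitary,
      neg_lt_zero]
    have hE : ∀ i, E y i.1 = y i := fun i ↦ Subtype.val_injective.extend_apply y 0 i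
    have hE' : ∀ i, ¬ 0 < hH.eigenvalues i → E y i = 0 := fun i hi ↦
      Function.extend_apply' _ _ _ (by rintro ⟨a, rfl⟩; exact hi a.2)
    obtain ⟨i₀, hi₀⟩ := Function.ne_iff.1 hy
    refine Finset.sum_pos' (fun i _ ↦ ?_) ⟨i₀.1, Finset.mem_univ _, ?_⟩
    · by_cases hi : 0 < hH.eigenvalues i
      · exact mul_nonneg hi.le (by positivity)
      · simp [hE' i hi]
    · rw [hE]
      exact mul_pos i₀.2 (by have := norm_pos_iff.2 hi₀; positivity)

/-- The rank counts the nonzero eigenvalues, and the eigenvectors of each sign span a definite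
subspace. With `add_le_rank_of_hasNeg` this is Sylvester's law of inertia. -/
theorem rank_le_negDim_add_negDim_neg {H : Matrix ι ι ℂ} (hH : H.IsHermitian) :
    H.rank ≤ negDim (quadForm H) + negDim (quadForm (-H)) := by
  have h1 := (hasNeg_card_eigenvalues_neg hH).le_negDim (quadForm_zero _)
  have h2 := (hasNeg_neg_card_eigenvalues_pos hH).le_negDim (quadForm_zero _)
  rw [hH.rank_eq_card_non_zero_eigs]
  refine le_trans ?_ (add_le_add h1 h2)
  simp only [Fintype.card_subtype]
  refine le_trans (Finset.card_le_card ?_) (Finset.card_union_le _ _)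
  intro i
  simp only [Finset.mem_filter, Finset.mem_univ, true_and, Finset.mem_union]
  exact fun h ↦ lt_or_gt_of_ne h

/-- The negative index of a continuous family of Hermitian matrices is locally constant where
the rank is. -/
theorem eventually_negDim_eq {T : Type*} [TopologicalSpace T] {H : T → Matrix ι ι ℂ}
    (hc : Continuous H) (hH : ∀ t, (H t).IsHermitian) {t₀ : T}
    (hr : ∀ᶠ t in 𝓝 t₀, (H t).rank = (H t₀).rank) :
    ∀ᶠ t in 𝓝 t₀, negDim (quadForm (H t)) = negDim (quadForm (H t₀)) := by
  -- Near `t₀` neither the negative nor the positive index can drop; their sum is the rank, which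
  -- does not change, so neither can rise.
  have a := eventually_hasNeg hc (hasNeg_negDim (quadForm_zero (H t₀)))
  have b := eventually_hasNeg (H := fun t ↦ -H t) hc.neg (hasNeg_negDim (quadForm_zero (-H t₀)))
  filter_upwards [a, b, hr] with t h1 h2 h3
  have h4 := add_le_rank_of_hasNeg (hH t) (hasNeg_negDim (quadForm_zero _)) h2
  have h5 := rank_le_negDim_add_negDim_neg (hH t₀)
  have h6 := h1.le_negDim (quadForm_zero _)
  omega

end Matrix

end SemiRiem

namespace SemiRiem

/-! ### Generic rank of analytic families of matrices -/

section Analytic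

variable {ι κ : Type*} [Fintype ι] [Fintype κ]

/-- `P` lifts coordinates of the range to the source, and `Q` reads them off through a retraction
onto the range. The determinant of `Q * _ * P` will play the role of a nonvanishing minor of maximal
size. -/
theorem exists_mul_mul_eq_one [DecidableEq ι] [DecidableEq κ] (M : Matrix ι κ ℂ) :
    ∃ (Q : Matrix (Fin M.rank) ι ℂ) (P : Matrix κ (Fin M.rank) ℂ), Q * M * P = 1 := by
  let f : (κ → ℂ) →ₗ[ℂ] (ι → ℂ) := Matrix.toLin' M
  let e : LinearMap.range f ≃ₗ[ℂ] (Fin M.rank → ℂ) :=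
    (Module.finBasisOfFinrankEq ℂ (LinearMap.range f) (by rw [Matrix.rank]; rfl)).equivFun
  obtain ⟨g, hg⟩ := f.rangeRestrict.exists_rightInverse_of_surjective f.range_rangeRestrict
  obtain ⟨l, hl⟩ := (LinearMap.range f).subtype.exists_leftInverse_of_injective (by simp)
  refine ⟨LinearMap.toMatrix' (e.toLinearMap ∘ₗ l), LinearMap.toMatrix' (g ∘ₗ e.symm.toLinearMap),
    ?_⟩
  apply Matrix.toLin'.injective
  rw [Matrix.toLin'_mul, Matrix.toLin'_mul, Matrix.toLin'_toMatrix', Matrix.toLin'_toMatrix',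
    Matrix.toLin'_one]
  refine LinearMap.ext fun x ↦ ?_
  have h1 : f (g (e.symm x)) = (e.symm x : ι → ℂ) := congrArg Subtype.val
    (LinearMap.congr_fun hg (e.symm x))
  have h2 := LinearMap.congr_fun hl (e.symm x)
  simp only [LinearMap.comp_apply, LinearEquiv.coe_coe, LinearMap.id_apply,
    Submodule.subtype_apply] at h2 ⊢
  change e (l (f (g (e.symm x)))) = x
  rw [h1, h2, LinearEquiv.apply_symm_apply]

theorem analyticOnNhd_det [DecidableEq ι] {M : ℝ → Matrix ι ι ℂ}
    (hM : ∀ i j, AnalyticOnNhd ℝ (fun t ↦ M t i j) Set.univ) :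
    AnalyticOnNhd ℝ (fun t ↦ (M t).det) Set.univ := by
  simp only [Matrix.det_apply']
  intro t _
  exact Finset.analyticAt_fun_sum _ fun σ _ ↦ analyticAt_const.mul
    (Finset.analyticAt_fun_prod _ fun i _ ↦ hM _ _ t trivial)

omit [Fintype ι] in
theorem analyticOnNhd_mul {ν : Type*} {A : ℝ → Matrix ι κ ℂ} {B : ℝ → Matrix κ ν ℂ}
    (hA : ∀ i j, AnalyticOnNhd ℝ (fun t ↦ A t i j) Set.univ)
    (hB : ∀ i j, AnalyticOnNhd ℝ (fun t ↦ B t i j) Set.univ) (i : ι) (j : ν) :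
    AnalyticOnNhd ℝ (fun t ↦ (A t * B t) i j) Set.univ := by
  simp only [Matrix.mul_apply]
  intro t _
  exact Finset.analyticAt_fun_sum _ fun k _ ↦ (hA _ _ t trivial).mul (hB _ _ t trivial)

/-- At a `t₀` of maximal rank choose `Q`, `P` as above. The determinant of `Q * M t * P` is analytic
and equals `1` at `t₀`; wherever it is nonzero, the rank of `M t` is at least the maximum. -/
theorem exists_generic_rank [DecidableEq ι] [DecidableEq κ] {M : ℝ → Matrix ι κ ℂ}
    (hM : ∀ i j, AnalyticOnNhd ℝ (fun t ↦ M t i j) Set.univ) :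
    ∃ (r : ℕ) (φ : ℝ → ℂ), AnalyticOnNhd ℝ φ Set.univ ∧ (∃ t, φ t ≠ 0) ∧
      ∀ t, φ t ≠ 0 → (M t).rank = r := by
  obtain ⟨t₀, ht₀⟩ : sSup (Set.range fun t ↦ (M t).rank) ∈ Set.range fun t ↦ (M t).rank :=
    Nat.sSup_mem ⟨_, 0, rfl⟩ ⟨Fintype.card κ, by rintro _ ⟨t, rfl⟩; exact (M t).rank_le_card_width⟩
  have hmax : ∀ t, (M t).rank ≤ (M t₀).rank := fun t ↦ by
    refine le_trans ?_ ht₀.ge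
    exact le_csSup ⟨Fintype.card κ, by rintro _ ⟨t, rfl⟩; exact (M t).rank_le_card_width⟩ ⟨t, rfl⟩
  obtain ⟨Q, P, hQP⟩ := exists_mul_mul_eq_one (M t₀)
  refine ⟨(M t₀).rank, fun t ↦ (Q * M t * P).det, analyticOnNhd_det ?_, ⟨t₀, by simp [hQP]⟩, ?_⟩
  · exact analyticOnNhd_mul (analyticOnNhd_mul (fun _ _ ↦ analyticOnNhd_const) hM)
      (fun _ _ ↦ analyticOnNhd_const)
  · intro t ht
    refine le_antisymm (hmax t) ?_
    have h1 : (Q * M t * P).rank = (M t₀).rank := by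
      rw [Matrix.rank_of_isUnit _ ((Matrix.isUnit_iff_isUnit_det _).2 (isUnit_iff_ne_zero.2 ht))]
      simp
    rw [← h1]
    exact (Matrix.rank_mul_le_left _ _).trans (Matrix.rank_mul_le_right _ _)

/-- Infinitely many zeros would accumulate in the compact interval, and the identity theorem would
make `φ` vanish everywhere. -/
theorem finite_zeros_Icc {φ : ℝ → ℂ} (hφ : AnalyticOnNhd ℝ φ Set.univ) {t₀ : ℝ} (h : φ t₀ ≠ 0)
    (a b : ℝ) : (Set.Icc a b ∩ {t | φ t = 0}).Finite := by
  by_contra hinf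
  obtain ⟨x, -, hx⟩ := Set.Infinite.exists_accPt_of_subset_isCompact hinf
    (isCompact_Icc (a := a) (b := b)) Set.inter_subset_left
  refine h (hφ.eqOn_zero_of_preconnected_of_frequently_eq_zero isPreconnected_univ
    (Set.mem_univ x) ?_ (Set.mem_univ t₀))
  exact (accPt_iff_frequently_nhdsNE.1 hx).mono fun y hy ↦ hy.2

/-- For analytic families `H` of Hermitian matrices and `L` of matrices, the negative index
of `H` on the kernel of `L` is constant on the intervals that avoid a finite set. -/
theorem negDim_ker_piecewise_const [DecidableEq ι] [DecidableEq κ] {H : ℝ → Matrix ι ι ℂ}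
    {L : ℝ → Matrix κ ι ℂ} (hH : ∀ t, (H t).IsHermitian)
    (haH : ∀ i j, AnalyticOnNhd ℝ (fun t ↦ H t i j) Set.univ)
    (haL : ∀ i j, AnalyticOnNhd ℝ (fun t ↦ L t i j) Set.univ) (a b : ℝ) :
    ∃ F : Finset ℝ, ∀ x y, a ≤ x → y ≤ b → x ≤ y → (∀ p ∈ F, p ∉ Set.Icc x y) →
      negDim (fun v : LinearMap.ker (L x).mulVecLin ↦ quadForm (H x) v) =
        negDim (fun v : LinearMap.ker (L y).mulVecLin ↦ quadForm (H y) v) := by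
  let B : ℝ → Matrix (ι ⊕ κ) (ι ⊕ κ) ℂ := fun t ↦ Matrix.fromBlocks (H t) (L t)ᴴ (L t) 0
  have hB : ∀ t, (B t).IsHermitian := fun t ↦
    Matrix.IsHermitian.fromBlocks (hH t) (Matrix.conjTranspose_conjTranspose _)
      Matrix.isHermitian_zero
  have haB : ∀ i j, AnalyticOnNhd ℝ (fun t ↦ B t i j) Set.univ := by
    rintro (i | i) (j | j)
    · exact haH i j
    · intro t _
      exact (Complex.conjCLE.toContinuousLinearMap.analyticAt _).comp (haL j i t trivial)
    · exact haL i j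
    · exact analyticOnNhd_const
  have hcB : Continuous B := by
    refine continuous_matrix fun i j ↦ ?_
    exact continuousOn_univ.1 (haB i j).continuousOn
  obtain ⟨r, φ, hφ, ⟨t₁, ht₁⟩, hr⟩ := exists_generic_rank haB
  obtain ⟨s, ψ, hψ, ⟨t₂, ht₂⟩, hs⟩ := exists_generic_rank haL
  have hfin := (finite_zeros_Icc hφ ht₁ a b).union (finite_zeros_Icc hψ ht₂ a b)
  refine ⟨hfin.toFinset, fun x y hax hyb hxy hF ↦ ?_⟩
  have hne : ∀ t ∈ Set.Icc x y, φ t ≠ 0 ∧ ψ t ≠ 0 := by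
    intro t ht
    have hab : t ∈ Set.Icc a b := ⟨hax.trans ht.1, ht.2.trans hyb⟩
    constructor <;> intro h0 <;> refine hF t ?_ ht <;> rw [Set.Finite.mem_toFinset]
    · exact Or.inl ⟨hab, h0⟩
    · exact Or.inr ⟨hab, h0⟩
  -- The rank of `B` is locally constant along the connected interval `[x, y]`, hence so is its
  -- index. The rank of `L` agrees at the two ends and can be subtracted.
  have hconst : negDim (quadForm (B x)) = negDim (quadForm (B y)) := by
    refine isPreconnected_Icc.constant (f := fun t ↦ negDim (quadForm (B t))) (s := Set.Icc x y)
      (fun t ht ↦ ?_) ⟨le_rfl, hxy⟩ ⟨hxy, le_rfl⟩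
    refine ContinuousAt.continuousWithinAt ?_
    have hrank : ∀ᶠ u in 𝓝 t, (B u).rank = (B t).rank := by
      have : ∀ᶠ u in 𝓝 t, φ u ≠ 0 := (hφ t trivial).continuousAt.eventually_ne (hne t ht).1
      filter_upwards [this] with u hu
      rw [hr u hu, hr t (hne t ht).1]
    exact continuousAt_const.congr
      ((eventually_negDim_eq hcB hB hrank).mono fun _ h ↦ h.symm)
  have hx := negDim_fromBlocks (H x) (L x)
  have hy := negDim_fromBlocks (H y) (L y)
  have h1 := hs x (hne x ⟨le_rfl, hxy⟩).2
  have h2 := hs y (hne y ⟨hxy, le_rfl⟩).2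
  simp only [B] at hconst
  omega

end Analytic

/-! ### Riemann sums of piecewise constant functions -/

/-- A function that is constant on the intervals in `[0, T]` avoiding a finite set is measurable
there and its Riemann sums differ from the integral by `O(1 / N)`. -/
theorem riemannSum_piecewise_const {T : ℝ} (hT : 0 < T) {f : ℝ → ℕ} {C : ℕ} (hC : ∀ t, f t ≤ C)
    {F : Finset ℝ} (hF : ∀ x y, 0 ≤ x → y ≤ T → x ≤ y → (∀ p ∈ F, p ∉ Set.Icc x y) → f x = f y) :
    MeasureTheory.IntegrableOn (fun t ↦ (f t : ℝ)) (Set.Icc 0 T) ∧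
    ∃ D : ℝ, ∀ N : ℕ, |(∑ k ∈ Finset.range N, (f (T * k / N) : ℝ)) -
      N * ((∫ t in (0 : ℝ)..T, (f t : ℝ)) / T)| ≤ D := by
  have hint : MeasureTheory.IntegrableOn (fun t ↦ (f t : ℝ)) (Set.Icc 0 T) := by
    set A : Set ℝ := Set.Ioo 0 T \ F with hA
    have hAo : IsOpen A := isOpen_Ioo.sdiff F.finite_toSet.isClosed
    have hcont : ContinuousOn (fun t ↦ (f t : ℝ)) A := by
      intro t ht
      obtain ⟨δ, hδ, hball⟩ := Metric.isOpen_iff.1 hAo t ht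
      refine ContinuousAt.continuousWithinAt (continuousAt_const.congr (f := fun _ ↦ (f t : ℝ)) ?_)
      filter_upwards [Metric.ball_mem_nhds t hδ] with u hu
      have hord : (Metric.ball t δ).OrdConnected := by
        rw [Real.ball_eq_Ioo]
        exact Set.ordConnected_Ioo
      have ht' := Metric.mem_ball_self (x := t) hδ
      rcases le_total u t with h | h
      · rw [hF u t (hball hu).1.1.le ht.1.2.le h fun p hp hpt ↦
          (hball (hord.out hu ht' hpt)).2 (Finset.mem_coe.2 hp)]
      · rw [hF t u ht.1.1.le (hball hu).1.2.le h fun p hp hpt ↦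
          (hball (hord.out ht' hu hpt)).2 (Finset.mem_coe.2 hp)]
    have h1 : MeasureTheory.IntegrableOn (fun t ↦ (f t : ℝ)) A := by
      refine MeasureTheory.IntegrableOn.of_bound (C := C) ?_
        (hcont.aestronglyMeasurable hAo.measurableSet) ?_
      · exact (MeasureTheory.measure_mono (Set.sdiff_subset.trans Set.Ioo_subset_Icc_self)).trans_lt
          measure_Icc_lt_top
      · exact Filter.Eventually.of_forall fun t ↦ by simpa using hC t
    have h2 : MeasureTheory.IntegrableOn (fun t ↦ (f t : ℝ)) (({0, T} : Set ℝ) ∪ F) := by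
      refine MeasureTheory.IntegrableOn.of_measure_zero ?_
      exact (((Set.finite_singleton T).insert 0).union F.finite_toSet).measure_zero _
    refine (h1.union h2).mono_set fun t ht ↦ ?_
    by_cases htF : t ∈ (F : Set ℝ)
    · exact Or.inr (Or.inr htF)
    rcases ht.1.eq_or_lt with h | h
    · exact Or.inr (Or.inl (Or.inl h.symm))
    rcases ht.2.eq_or_lt with h' | h'
    · exact Or.inr (Or.inl (Or.inr h'))
    · exact Or.inl ⟨⟨h, h'⟩, htF⟩
  -- Only cells meeting `F` contribute an error, at most `C` each, and a point of `F` lies in at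
  -- most two closed cells.
  refine ⟨hint, 2 * F.card * C, fun N ↦ ?_⟩
  rcases Nat.eq_zero_or_pos N with rfl | hN
  · simp; positivity
  have hN' : (0 : ℝ) < N := by exact_mod_cast hN
  let x : ℕ → ℝ := fun k ↦ T * k / N
  have hx0 : ∀ k, 0 ≤ x k := fun k ↦ by positivity
  have hxT : ∀ k ≤ N, x k ≤ T := fun k hk ↦ by
    have : (k : ℝ) ≤ N := by exact_mod_cast hk
    simp only [x]
    rw [div_le_iff₀ hN']
    gcongr
  have hxs : ∀ k, x (k + 1) = x k + T / N := fun k ↦ by simp only [x]; push_cast; ring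
  have hxle : ∀ k, x k ≤ x (k + 1) := fun k ↦ by rw [hxs]; linarith [div_pos hT hN']
  have hii : ∀ k < N, IntervalIntegrable (fun t ↦ (f t : ℝ)) MeasureTheory.volume
      (x k) (x (k + 1)) := fun k hk ↦ by
    rw [intervalIntegrable_iff_integrableOn_Icc_of_le (hxle k)]
    exact hint.mono_set (Set.Icc_subset_Icc (hx0 k) (hxT _ hk))
  have hsum : ∑ k ∈ Finset.range N, ∫ t in x k..x (k + 1), (f t : ℝ) =
      ∫ t in (0 : ℝ)..T, (f t : ℝ) := by
    rw [intervalIntegral.sum_integral_adjacent_intervals hii]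
    simp [x, hN'.ne']
  let S : ℕ → Finset ℝ := fun k ↦ F.filter fun p ↦ p ∈ Set.Icc (x k) (x (k + 1))
  have hterm : ∀ k ∈ Finset.range N,
      |(f (x k) : ℝ) - N / T * ∫ t in x k..x (k + 1), (f t : ℝ)| ≤ (S k).card * C := by
    intro k hk
    have hk' := Finset.mem_range.1 hk
    have hc : (f (x k) : ℝ) = N / T * ∫ t in x k..x (k + 1), (f (x k) : ℝ) := by
      rw [intervalIntegral.integral_const, hxs]
      simp only [add_sub_cancel_left, smul_eq_mul]
      field_simp
    by_cases hS : S k = ∅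
    · have : ∫ t in x k..x (k + 1), (f t : ℝ) = ∫ t in x k..x (k + 1), (f (x k) : ℝ) := by
        refine intervalIntegral.integral_congr fun t ht ↦ ?_
        rw [Set.uIcc_of_le (hxle k)] at ht
        rw [hF (x k) t (hx0 k) (ht.2.trans (hxT _ hk')) ht.1 fun p hp hpt ↦ ?_]
        have : p ∈ S k := Finset.mem_filter.2 ⟨hp, hpt.1, hpt.2.trans ht.2⟩
        simp [hS] at this
      rw [this, ← hc]
      simp [hS]
    -- Both the sampled value and the mean over the cell lie in `[0, C]`.
    · have h1 : (1 : ℝ) ≤ (S k).card := by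
        exact_mod_cast Finset.card_pos.2 (Finset.nonempty_iff_ne_empty.2 hS)
      have h0 : 0 ≤ ∫ t in x k..x (k + 1), (f t : ℝ) :=
        intervalIntegral.integral_nonneg (hxle k) fun _ _ ↦ Nat.cast_nonneg _
      have h2 : ∫ t in x k..x (k + 1), (f t : ℝ) ≤ ∫ t in x k..x (k + 1), (C : ℝ) :=
        intervalIntegral.integral_mono_on (hxle k) (hii k hk') (by simp)
          fun t _ ↦ by exact_mod_cast hC t
      have h3 : N / T * ∫ t in x k..x (k + 1), (C : ℝ) = C := by
        rw [intervalIntegral.integral_const, hxs]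
        simp only [add_sub_cancel_left, smul_eq_mul]
        field_simp
      have h4 : N / T * ∫ t in x k..x (k + 1), (f t : ℝ) ≤ C := by
        rw [← h3]
        gcongr
      have h5 : 0 ≤ N / T * ∫ t in x k..x (k + 1), (f t : ℝ) := by positivity
      have h6 : (f (x k) : ℝ) ≤ C := by exact_mod_cast hC _
      have h7 : (0 : ℝ) ≤ f (x k) := Nat.cast_nonneg _
      have h8 : (C : ℝ) ≤ (S k).card * C := le_mul_of_one_le_left (Nat.cast_nonneg _) h1
      rw [abs_le]
      constructor <;> linarith
  have hcard : ∑ k ∈ Finset.range N, (S k).card ≤ 2 * F.card := by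
    simp only [S, Finset.card_filter]
    rw [Finset.sum_comm, mul_comm, ← smul_eq_mul]
    refine Finset.sum_le_card_nsmul _ _ _ fun p _ ↦ ?_
    rw [← Finset.card_filter]
    -- A cell containing `p` satisfies `k ≤ p * N / T ≤ k + 1`; both values of `k` occur when `p` is
    -- a node shared by two cells.
    have hsub : (Finset.range N).filter (fun k ↦ p ∈ Set.Icc (x k) (x (k + 1))) ⊆
        {⌊p * N / T⌋₊, ⌊p * N / T⌋₊ - 1} := by
      intro k hk
      obtain ⟨-, h1, h2⟩ := Finset.mem_filter.1 hk
      have h1' : (k : ℝ) ≤ p * N / T := by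
        simp only [x] at h1
        rw [div_le_iff₀ hN'] at h1
        rw [le_div_iff₀ hT]
        linarith
      have h2' : p * N / T ≤ k + 1 := by
        simp only [x] at h2
        rw [le_div_iff₀ hN'] at h2
        rw [div_le_iff₀ hT]
        push_cast at h2
        linarith
      have a := Nat.le_floor h1'
      have b : ⌊p * N / T⌋₊ ≤ k + 1 := by
        have := Nat.floor_le_floor h2'
        rwa [← Nat.cast_succ, Nat.floor_natCast] at this
      simp only [Finset.mem_insert, Finset.mem_singleton]
      omega
    exact (Finset.card_le_card hsub).trans Finset.card_le_two
  calc |(∑ k ∈ Finset.range N, (f (T * k / N) : ℝ)) - N * ((∫ t in (0 : ℝ)..T, (f t : ℝ)) / T)|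
      = |∑ k ∈ Finset.range N, ((f (x k) : ℝ) - N / T * ∫ t in x k..x (k + 1), (f t : ℝ))| := by
        rw [Finset.sum_sub_distrib, ← Finset.mul_sum, hsum]
        congr 2
        ring
    _ ≤ ∑ k ∈ Finset.range N, ((S k).card * C : ℝ) :=
        (Finset.abs_sum_le_sum_abs _ _).trans (Finset.sum_le_sum hterm)
    _ ≤ 2 * F.card * C := by
        rw [← Finset.sum_mul]
        gcongr
        exact_mod_cast hcard

end SemiRiem

namespace SemiRiem

/-! ### The index function on the circle -/

section Reduction

variable {n : ℕ}

/-- The values of a solution of the Jacobi equation and of its derivative at `0` and `1`. -/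
noncomputable def boundaryValues (Γ Rbar : ℝ → Matrix (Fin n) (Fin n) ℝ) :
    jacobiSolutions Γ Rbar →ₗ[ℂ]
      ((Fin n → ℂ) × (Fin n → ℂ)) × ((Fin n → ℂ) × (Fin n → ℂ)) where
  toFun V := ((V.1 0, V.1 1), (deriv V.1 0, deriv V.1 1))
  map_add' V W := by
    have h : ∀ r, deriv (V.1 + W.1) r = deriv V.1 r + deriv W.1 r := fun r ↦
      deriv_add (V.2.1.differentiable (by norm_num) r) (W.2.1.differentiable (by norm_num) r)
    simp [h]
  map_smul' c V := by
    have h : ∀ r, deriv (c • V.1) r = c • deriv V.1 r := fun r ↦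
      deriv_const_smul c (V.2.1.differentiable (by norm_num) r)
    simp [h]

theorem re_sesqG (ε : Fin n → ℝ) (v w : Fin n → ℂ) :
    (sesqG ε v w).re = (star w ⬝ᵥ Matrix.diagonal (fun i ↦ (ε i : ℂ)) *ᵥ v).re := by
  congr 1
  simp only [sesqG, dotProduct, Matrix.mulVec_diagonal, Pi.star_apply, Complex.star_def]
  exact Finset.sum_congr rfl fun i _ ↦ by ring

/-- The matrix, at `z`, of the form `(x, y) ↦ G((z̄ d - c) x, a y)`. -/
noncomputable def twistedMatrix {m : ℕ} (ε : Fin n → ℝ) (a c d : Matrix (Fin n) (Fin m) ℂ) (z : ℂ) :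
    Matrix (Fin m) (Fin m) ℂ :=
  aᴴ * Matrix.diagonal (fun i ↦ (ε i : ℂ)) * (starRingEnd ℂ z • d - c)

/-- Adding the adjoint gives a Hermitian matrix by construction, without recourse to the symmetry of
$b_z$. The index depends only on the real part of the diagonal values, which is merely doubled. -/
theorem quadForm_twistedMatrix {m : ℕ} (ε : Fin n → ℝ) (a c d : Matrix (Fin n) (Fin m) ℂ) (z : ℂ)
    (x : Fin m → ℂ) :
    quadForm (twistedMatrix ε a c d z + (twistedMatrix ε a c d z)ᴴ) x =
      2 * (sesqG ε (starRingEnd ℂ z • (d *ᵥ x) - c *ᵥ x) (a *ᵥ x)).re := by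
  have h1 : (star x ⬝ᵥ (twistedMatrix ε a c d z)ᴴ *ᵥ x).re =
      (star x ⬝ᵥ twistedMatrix ε a c d z *ᵥ x).re := by
    rw [Matrix.dotProduct_mulVec, ← Matrix.star_mulVec, Matrix.star_dotProduct]
    simp
  have h2 : star x ⬝ᵥ twistedMatrix ε a c d z *ᵥ x = star (a *ᵥ x) ⬝ᵥ
      Matrix.diagonal (fun i ↦ (ε i : ℂ)) *ᵥ (starRingEnd ℂ z • (d *ᵥ x) - c *ᵥ x) := by
    rw [twistedMatrix, Matrix.star_mulVec, ← Matrix.dotProduct_mulVec, ← Matrix.smul_mulVec,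
      ← Matrix.sub_mulVec, Matrix.mulVec_mulVec, Matrix.mulVec_mulVec, Matrix.mul_assoc]
  rw [quadForm, Matrix.add_mulVec, dotProduct_add, Complex.add_re, h1, h2, re_sesqG]
  ring

/-- The form `b_z` sees a solution only through its values and derivatives at `0` and `1`, so its
index is that of a form on the kernel of a matrix, both affine in `z` or `z̄`. This uses no property
of the coefficients of the Jacobi equation. -/
theorem exists_matrices_nMinus (ε : Fin n → ℝ) (Γ Rbar : ℝ → Matrix (Fin n) (Fin n) ℝ) :
    ∃ (m : ℕ) (a b c d : Matrix (Fin n) (Fin m) ℂ), ∀ z : Circle, nMinus ε Γ Rbar z =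
      negDim fun v : LinearMap.ker (b - (z : ℂ) • a).mulVecLin ↦
        quadForm (twistedMatrix ε a c d z + (twistedMatrix ε a c d z)ᴴ) v := by
  let ev := boundaryValues Γ Rbar
  let R := LinearMap.range ev
  let e : R ≃ₗ[ℂ] (Fin (Module.finrank ℂ R) → ℂ) := (Module.finBasis ℂ R).equivFun
  let ρ := R.subtype ∘ₗ e.symm.toLinearMap
  -- `π` sends a solution to the coordinates of its boundary values; `σ` below chooses a solution
  -- linearly from such coordinates.
  let π : jacobiSolutions Γ Rbar →ₗ[ℂ] (Fin (Module.finrank ℂ R) → ℂ) :=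
    e.toLinearMap ∘ₗ ev.rangeRestrict
  have hρπ : ∀ V, ρ (π V) = ev V := fun V ↦ by simp [ρ, π]
  obtain ⟨σ', hσ'⟩ := ev.rangeRestrict.exists_rightInverse_of_surjective ev.range_rangeRestrict
  let σ := σ' ∘ₗ e.symm.toLinearMap
  have hσ : ∀ x, ev (σ x) = ρ x := fun x ↦ congrArg Subtype.val (LinearMap.congr_fun hσ' (e.symm x))
  let a := LinearMap.toMatrix' (LinearMap.fst ℂ _ _ ∘ₗ LinearMap.fst ℂ _ _ ∘ₗ ρ)
  let b := LinearMap.toMatrix' (LinearMap.snd ℂ _ _ ∘ₗ LinearMap.fst ℂ _ _ ∘ₗ ρ)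
  let c := LinearMap.toMatrix' (LinearMap.fst ℂ _ _ ∘ₗ LinearMap.snd ℂ _ _ ∘ₗ ρ)
  let d := LinearMap.toMatrix' (LinearMap.snd ℂ _ _ ∘ₗ LinearMap.snd ℂ _ _ ∘ₗ ρ)
  have ha : ∀ x, a *ᵥ x = (ρ x).1.1 := fun x ↦ LinearMap.toMatrix'_mulVec _ x
  have hb : ∀ x, b *ᵥ x = (ρ x).1.2 := fun x ↦ LinearMap.toMatrix'_mulVec _ x
  have hc : ∀ x, c *ᵥ x = (ρ x).2.1 := fun x ↦ LinearMap.toMatrix'_mulVec _ x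
  have hd : ∀ x, d *ᵥ x = (ρ x).2.2 := fun x ↦ LinearMap.toMatrix'_mulVec _ x
  refine ⟨_, a, b, c, d, fun z ↦ ?_⟩
  rw [nMinus, negIndex_eq_negDim _ (by simp [bForm, sesqG])]
  have hker : ∀ x, x ∈ LinearMap.ker (b - (z : ℂ) • a).mulVecLin ↔
      (ρ x).1.2 = (z : ℂ) • (ρ x).1.1 := fun x ↦ by
    rw [LinearMap.mem_ker, Matrix.mulVecLin_apply, Matrix.sub_mulVec, Matrix.smul_mulVec, ha, hb,
      sub_eq_zero]
  let f : twistedJacobi Γ Rbar z →ₗ[ℂ] LinearMap.ker (b - (z : ℂ) • a).mulVecLin :=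
    LinearMap.codRestrict _ (π ∘ₗ Submodule.inclusion fun V hV ↦ hV.1) fun V ↦ by
      refine (hker _).2 ?_
      have h := hρπ ⟨V.1, V.2.1⟩
      exact (congrArg (fun w ↦ w.1.2) h).trans
        (V.2.2.trans (congrArg (fun w ↦ (z : ℂ) • w.1.1) h).symm)
  let g : LinearMap.ker (b - (z : ℂ) • a).mulVecLin →ₗ[ℂ] twistedJacobi Γ Rbar z :=
    LinearMap.codRestrict _ ((jacobiSolutions Γ Rbar).subtype ∘ₗ σ ∘ₗ Submodule.subtype _)
      fun x ↦ by
        refine ⟨(σ x).2, ?_⟩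
        have h := (hker x).1 x.2
        rw [← hσ] at h
        exact h
  have hform : ∀ x (V : jacobiSolutions Γ Rbar), ev V = ρ x →
      quadForm (twistedMatrix ε a c d z + (twistedMatrix ε a c d z)ᴴ) x =
        2 * (sesqG ε (starRingEnd ℂ (z : ℂ) • deriv V.1 1 - deriv V.1 0) (V.1 0)).re := by
    intro x V hV
    rw [quadForm_twistedMatrix, ha, hc, hd, ← hV]
    rfl
  -- `f` forgets the solutions whose boundary data vanish, but the form does not see them.
  refine negDim_congr f g (fun V hV ↦ ?_) fun x hx ↦ ?_
  · rw [hform (f V) ⟨V.1, V.2.1⟩ (hρπ _).symm]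
    exact mul_neg_of_pos_of_neg two_pos hV
  · rw [hform x (σ x) (hσ x)] at hx
    exact (pos_iff_neg_of_mul_neg hx).1 two_pos

theorem analyticAt_circleExp (t : ℝ) : AnalyticAt ℝ (fun t : ℝ ↦ (Circle.exp t : ℂ)) t := by
  simp only [Circle.coe_exp]
  have h : AnalyticAt ℝ (fun t : ℝ ↦ (t : ℂ) * Complex.I) t :=
    (Complex.ofRealCLM.analyticAt t).mul analyticAt_const
  exact (analyticAt_cexp.restrictScalars (𝕜 := ℝ)).comp h

/-- The angle is the right parameter: conjugation is not holomorphic, but it preserves real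
analyticity in `t`. The bound `C` is the dimension `m` of the coordinate space. -/
theorem nMinus_piecewise_const (ε : Fin n → ℝ) (Γ Rbar : ℝ → Matrix (Fin n) (Fin n) ℝ) :
    ∃ (C : ℕ) (F : Finset ℝ), (∀ t, nMinus ε Γ Rbar (Circle.exp t) ≤ C) ∧
      ∀ x y, 0 ≤ x → y ≤ 2 * Real.pi → x ≤ y → (∀ p ∈ F, p ∉ Set.Icc x y) →
        nMinus ε Γ Rbar (Circle.exp x) = nMinus ε Γ Rbar (Circle.exp y) := by
  obtain ⟨m, a, b, c, d, h⟩ := exists_matrices_nMinus ε Γ Rbar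
  have hconj : ∀ {u : ℝ → ℂ}, AnalyticOnNhd ℝ u Set.univ →
      AnalyticOnNhd ℝ (fun t ↦ starRingEnd ℂ (u t)) Set.univ := fun hu t ht ↦
    (Complex.conjCLE.toContinuousLinearMap.analyticAt _).comp (hu t ht)
  have hz : AnalyticOnNhd ℝ (fun t : ℝ ↦ (Circle.exp t : ℂ)) Set.univ :=
    fun t _ ↦ analyticAt_circleExp t
  have hK : ∀ i j, AnalyticOnNhd ℝ
      (fun t : ℝ ↦ twistedMatrix ε a c d (Circle.exp t) i j) Set.univ := by
    refine analyticOnNhd_mul (fun _ _ ↦ analyticOnNhd_const) fun i j ↦ ?_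
    exact ((hconj hz).mul analyticOnNhd_const).sub analyticOnNhd_const
  obtain ⟨F, hF⟩ := negDim_ker_piecewise_const
    (H := fun t ↦ twistedMatrix ε a c d (Circle.exp t) + (twistedMatrix ε a c d (Circle.exp t))ᴴ)
    (L := fun t ↦ b - (Circle.exp t : ℂ) • a)
    (fun t ↦ Matrix.isHermitian_add_transpose_self _)
    (fun i j ↦ (hK i j).add (hconj (hK j i)))
    (fun i j ↦ analyticOnNhd_const.sub (hz.mul analyticOnNhd_const)) 0 (2 * Real.pi)
  refine ⟨m, F, fun t ↦ ?_, fun x y hx hy hxy hp ↦ ?_⟩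
  · rw [h]
    refine (negDim_le_finrank (by simp)).trans ?_
    simpa using Submodule.finrank_le (LinearMap.ker (b - (Circle.exp t : ℂ) • a).mulVecLin)
  · rw [h, h]
    exact hF x y hx hy hxy hp

end Reduction

end SemiRiem

/-! ### The mean index and the growth of the sequence -/

theorem proposition6p8 {n : ℕ} {M : Type*} [TopologicalSpace M]
    [ChartedSpace (EuclideanSpace ℝ (Fin n)) M] [IsManifold (𝓡 n) ∞ M]
    (g : SemiRiem.SemiRiemannianMetric n M)
    (γ : ℝ → M) (hγ : SemiRiem.IsClosedGeodesic g γ)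
    (ε : Fin n → ℝ) (T : Fin n → ∀ t, TangentSpace (𝓡 n) (γ t))
    (hT : SemiRiem.IsPeriodicOrthonormalFrame g γ ε T)
    (Γ Rbar : ℝ → Matrix (Fin n) (Fin n) ℝ)
    (hΓ : SemiRiem.IsFrameChristoffel g γ T Γ) (hR : SemiRiem.IsFrameCurvature g γ T Rbar) :
    ∃ K : ℝ,
      Filter.Tendsto (fun N : ℕ ↦ (SemiRiem.BSeq ε Γ Rbar N : ℝ) / (N : ℝ)) Filter.atTop (𝓝 K) ∧
      0 ≤ K ∧
      (K = 0 ↔ BddAbove (Set.range (SemiRiem.BSeq ε Γ Rbar))) ∧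
      (BddAbove (Set.range (SemiRiem.BSeq ε Γ Rbar)) ↔
        ∀ᵐ θ : ℝ ∂(MeasureTheory.volume.restrict (Set.Icc 0 (2 * Real.pi))),
          SemiRiem.nMinus ε Γ Rbar (Circle.exp θ) = 0) ∧
      (¬ BddAbove (Set.range (SemiRiem.BSeq ε Γ Rbar)) →
        ∃ α : ℝ, ∀ N P : ℕ,
          K * P - α ≤ (SemiRiem.BSeq ε Γ Rbar (N + P) : ℝ) - (SemiRiem.BSeq ε Γ Rbar N : ℝ) ∧
          (SemiRiem.BSeq ε Γ Rbar (N + P) : ℝ) - (SemiRiem.BSeq ε Γ Rbar N : ℝ) ≤ K * P + α) := by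
  obtain ⟨C, F, hC, hF⟩ := SemiRiem.nMinus_piecewise_const ε Γ Rbar
  obtain ⟨hint, D, hD⟩ := SemiRiem.riemannSum_piecewise_const Real.two_pi_pos hC hF
  set f : ℝ → ℝ := fun t ↦ (SemiRiem.nMinus ε Γ Rbar (Circle.exp t) : ℝ)
  set K : ℝ := (∫ t in (0 : ℝ)..(2 * Real.pi), f t) / (2 * Real.pi) with hK
  have hB : ∀ N : ℕ, |(SemiRiem.BSeq ε Γ Rbar N : ℝ) - N * K| ≤ D := fun N ↦ by
    simpa [SemiRiem.BSeq] using hD N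
  have hlim : Filter.Tendsto (fun N : ℕ ↦ (SemiRiem.BSeq ε Γ Rbar N : ℝ) / (N : ℝ))
      Filter.atTop (𝓝 K) := by
    rw [tendsto_iff_norm_sub_tendsto_zero]
    refine squeeze_zero' (.of_forall fun _ ↦ norm_nonneg _) ?_
      (tendsto_const_div_atTop_nhds_zero_nat D)
    filter_upwards [Filter.eventually_gt_atTop 0] with N hN
    have hN' : (0 : ℝ) < N := by exact_mod_cast hN
    have : (SemiRiem.BSeq ε Γ Rbar N : ℝ) / N - K = ((SemiRiem.BSeq ε Γ Rbar N : ℝ) - N * K) / N := by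
      field_simp
    rw [this, norm_div, Real.norm_eq_abs, Real.norm_natCast]
    gcongr
    exact hB N
  have hK0 : K = 0 ↔ BddAbove (Set.range (SemiRiem.BSeq ε Γ Rbar)) := by
    constructor
    · intro h
      refine ⟨⌊D⌋₊, ?_⟩
      rintro _ ⟨N, rfl⟩
      have := hB N
      rw [h, mul_zero, sub_zero] at this
      exact Nat.le_floor ((le_abs_self _).trans this)
    -- For bounded `BSeq` the quotients by `N` tend to `0`, and limits are unique.
    · rintro ⟨A, hA⟩
      refine tendsto_nhds_unique hlim (squeeze_zero (fun N ↦ by positivity) (fun N ↦ ?_)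
        (tendsto_const_div_atTop_nhds_zero_nat (A : ℝ)))
      gcongr
      exact hA ⟨N, rfl⟩
  have hae : K = 0 ↔ ∀ᵐ θ : ℝ ∂(MeasureTheory.volume.restrict (Set.Icc 0 (2 * Real.pi))),
      SemiRiem.nMinus ε Γ Rbar (Circle.exp θ) = 0 := by
    rw [hK, div_eq_zero_iff, or_iff_left Real.two_pi_pos.ne',
      intervalIntegral.integral_of_le Real.two_pi_pos.le,
      ← MeasureTheory.integral_Icc_eq_integral_Ioc,
      MeasureTheory.integral_eq_zero_iff_of_nonneg (fun t ↦ Nat.cast_nonneg _) hint]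
    simp [Filter.EventuallyEq]
  -- `2 * D` comes from subtracting the estimates `hB` at `N + P` and at `N`.
  refine ⟨K, hlim, ?_, hK0, hK0.symm.trans hae, fun _ ↦ ⟨2 * D, fun N P ↦ ?_⟩⟩
  · exact div_nonneg (intervalIntegral.integral_nonneg Real.two_pi_pos.le
      fun t _ ↦ Nat.cast_nonneg _) Real.two_pi_pos.le
  · have h1 := abs_le.1 (hB (N + P))
    have h2 := abs_le.1 (hB N)
    push_cast at h1
    constructor <;> linarith [h1.1, h1.2, h2.1, h2.2]
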